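/- All hypergraphs $\mathcal H=(V,\mathcal E)$ are finite and have no multiple hyperedges. A hypergraph is $k$-uniform if every hyperedge has exactly $k$ vertices. The edge intersection hypergraph $EI(\mathcal H)$ of $\mathcal H=(V,\mathcal E)$ has vertex set $V$ and hyperedge set $$\{e_1\cap e_2 \mid e_1,e_2\in\mathcal E,\ e_1\ne e_2,\ |e_1\cap e_2|\ge 2\}.$$ Let $C_n$ be the cycle with vertex set $V=\{1,\dots,n\}$ and edges $\{i,i+1\}$, $i\in V$ (indices modulo $n$), regarded as a 2-uniform hypergraph, and let $\mu^k_n$ denote the minimum number of hyperedges of a $k$-uniform hypergraph $\mathcal H$ with $EI(\mathcal H)=C_n$. Let $n\ge 24$. Then there exists a 6-uniform hypergraph $\mathcal H=(V,\mathcal E)$ with $EI(\mathcal H)=C_n$ and $|\mathcal E|=\lceil n/2\rceil$. Moreover, $\mu^6_n=\lceil n/2\rceil$. -/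

import Mathlib

namespace Hypergraph

variable {α : Type*}

/-- A hypergraph is `k`-uniform if all its hyperedges have exactly `k` elements. -/
def IsUniform (H : Hypergraph α) (k : ℕ) : Prop :=
  ∀ e ∈ H.edgeSet, e.encard = k

/-- The edge intersection hypergraph `EI(H)`: it has the vertex set of `H`, and its hyperedges are
the intersections with at least two elements of two distinct hyperedges of `H`. -/
def edgeIntersection (H : Hypergraph α) : Hypergraph α where
  vertexSet := H.vertexSet
  edgeSet := {e | ∃ e₁ ∈ H.edgeSet, ∃ e₂ ∈ H.edgeSet,
    e₁ ≠ e₂ ∧ 2 ≤ (e₁ ∩ e₂).encard ∧ e = e₁ ∩ e₂}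
  subset_vertexSet_of_mem_edgeSet' := by
    rintro e ⟨e₁, h₁, e₂, -, -, -, rfl⟩
    exact Set.inter_subset_left.trans (H.subset_vertexSet_of_mem_edgeSet' h₁)

/-- A simple graph, regarded as a 2-uniform hypergraph on all the vertices of the graph. -/
def ofSimpleGraph (G : SimpleGraph α) : Hypergraph α where
  vertexSet := Set.univ
  edgeSet := {e | ∃ u v, G.Adj u v ∧ e = {u, v}}
  subset_vertexSet_of_mem_edgeSet' := fun _ _ => Set.subset_univ _

/-- The cycle `C_n` on the vertex set `Fin n`, as a hypergraph. -/
def cycle (n : ℕ) : Hypergraph (Fin n) :=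
  ofSimpleGraph (SimpleGraph.cycleGraph n)

/-- The minimum number of hyperedges of a `k`-uniform hypergraph `H` with `EI(H) = C_n`
(with value `0` if there is no such hypergraph). -/
noncomputable def mu (k n : ℕ) : ℕ :=
  sInf {m | ∃ H : Hypergraph (Fin n),
    H.IsUniform k ∧ H.edgeIntersection = cycle n ∧ H.edgeSet.ncard = m}

end Hypergraph

/-! Lower bound, by double counting: a vertex of the cycle lies on two cycle edges, each the
intersection of two hyperedges through that vertex. Two hyperedges have only one intersection, so at
least three pass through each vertex, and `3 * n ≤ 6 * |E|`.

Upper bound: for even `n` take the `n / 2` even translates of `{0, 1, 2, 3, 9, 10}` modulo `n`. The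
even differences in this set are 2 (0 to 2, 1 to 3), 8 (1 to 9, 2 to 10), and 6 and 10, once each.
So translates share two points only at shift 2, giving the edges `{even, even + 1}`, or at shift 8,
giving `{odd, odd + 1}`. Two of these differences sum to at most 20 < `n`, so wrapping around
creates no further coincidences. For odd `n`, delete a vertex from the family for `n + 1` and repair
the three hyperedges through it. -/

namespace Hypergraph

variable {α : Type*}

/-! ### Families of sets realizing a triangle-free graph -/

/-- A family of `k`-sets, indexed by `Fin m`, in which two members share two given points only if
these are adjacent in a triangle-free graph `G`, and which covers each edge of `G` twice, is the
hyperedge set of a hypergraph with edge intersection hypergraph `G`. -/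
theorem exists_edgeIntersection_eq_ofSimpleGraph {m k : ℕ} (G : SimpleGraph α) (hk : 3 ≤ k)
    (hG : ∀ x y z, G.Adj x y → G.Adj y z → ¬ G.Adj x z) (F : Fin m → Finset α)
    (hcard : ∀ i, (F i).card = k)
    (hpair : ∀ i j, i ≠ j → ∀ x y, x ≠ y → x ∈ F i → x ∈ F j → y ∈ F i → y ∈ F j → G.Adj x y)
    (hcov : ∀ x y, G.Adj x y → ∃ i j, i ≠ j ∧ x ∈ F i ∧ x ∈ F j ∧ y ∈ F i ∧ y ∈ F j) :
    ∃ H : Hypergraph α, H.IsUniform k ∧ H.edgeIntersection = ofSimpleGraph G ∧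
      H.edgeSet.ncard = m := by
  classical
  -- Three common points of two members would form a triangle in `G`.
  have hno : ∀ i j, i ≠ j → ∀ x y z, x ≠ y → y ≠ z → x ≠ z → x ∈ F i → x ∈ F j → y ∈ F i →
      y ∈ F j → z ∈ F i → z ∈ F j → False := fun i j hij x y z hxy hyz hxz h1 h2 h3 h4 h5 h6 =>
    hG x y z (hpair i j hij x y hxy h1 h2 h3 h4) (hpair i j hij y z hyz h3 h4 h5 h6)
      (hpair i j hij x z hxz h1 h2 h5 h6)
  -- Equal members would share `k ≥ 3` points; injectivity makes the number of hyperedges exactly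
  -- `m`.
  have hinj : Function.Injective F := by
    intro i j hij
    by_contra hne
    obtain ⟨x, y, z, hx, hy, hz, hxy, hxz, hyz⟩ := Finset.two_lt_card_iff.1
      (show 2 < (F i).card by rw [hcard]; omega)
    exact hno i j hne x y z hxy hyz hxz hx (hij ▸ hx) hy (hij ▸ hy) hz (hij ▸ hz)
  have hinter : ∀ i j, i ≠ j → ∀ x y, x ≠ y → x ∈ F i → x ∈ F j → y ∈ F i → y ∈ F j →
      (F i : Set α) ∩ F j = {x, y} := by
    intro i j hij x y hxy h1 h2 h3 h4
    ext z
    simp only [Set.mem_inter_iff, Finset.mem_coe, Set.mem_insert_iff, Set.mem_singleton_iff]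
    constructor
    · rintro ⟨hz, hz'⟩
      by_contra! hne
      exact hno i j hij x y z hxy hne.2.symm hne.1.symm h1 h2 h3 h4 hz hz'
    · rintro (rfl | rfl)
      exacts [⟨h1, h2⟩, ⟨h3, h4⟩]
  refine ⟨⟨Set.univ, Set.range fun i => (F i : Set α), fun _ _ => Set.subset_univ _⟩, ?_, ?_, ?_⟩
  · rintro _ ⟨i, rfl⟩
    simp [hcard]
  · refine Hypergraph.ext rfl ?_
    ext e
    constructor
    · rintro ⟨_, ⟨i, rfl⟩, _, ⟨j, rfl⟩, hne, h2, rfl⟩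
      have hij : i ≠ j := fun h => hne (by rw [h])
      obtain ⟨x, y, hx, hy, hxy⟩ := Set.one_lt_encard_iff.1
        (lt_of_lt_of_le (by norm_num) h2)
      exact ⟨x, y, hpair i j hij x y hxy hx.1 hx.2 hy.1 hy.2,
        hinter i j hij x y hxy hx.1 hx.2 hy.1 hy.2⟩
    · rintro ⟨x, y, hadj, rfl⟩
      obtain ⟨i, j, hij, h1, h2, h3, h4⟩ := hcov x y hadj
      have h := hinter i j hij x y hadj.ne h1 h2 h3 h4
      refine ⟨_, ⟨i, rfl⟩, _, ⟨j, rfl⟩, fun he => hij (hinj (Finset.coe_injective he)), ?_, h.symm⟩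
      rw [h, Set.encard_pair hadj.ne]
  · change (Set.range fun i => (F i : Set α)).ncard = m
    rw [← Set.image_univ, Set.ncard_image_of_injective _
      (fun i j h => hinj (Finset.coe_injective h)), Set.ncard_univ, Nat.card_fin]

/-! ### Lower bound by double counting -/

/-- A vertex with two distinct neighbours in `G = EI(H)` lies in at least three hyperedges. -/
theorem three_le_card_of_edgeIntersection_eq {G : SimpleGraph α} {H : Hypergraph α}
    (hH : H.edgeIntersection = ofSimpleGraph G) {u v w : α} (huv : G.Adj v u) (hvw : G.Adj v w)
    (huw : u ≠ w) (S : Finset (Set α)) (hS : ∀ e, e ∈ S ↔ e ∈ H.edgeSet ∧ v ∈ e) :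
    3 ≤ S.card := by
  classical
  have key : ∀ t, G.Adj v t → ∃ e₁ ∈ S, ∃ e₂ ∈ S, e₁ ≠ e₂ ∧ {v, t} = e₁ ∩ e₂ := by
    intro t ht
    have hmem : ({v, t} : Set α) ∈ H.edgeIntersection.edgeSet := by
      rw [hH]
      exact ⟨v, t, ht, rfl⟩
    obtain ⟨e₁, h₁, e₂, h₂, hne, -, h⟩ := hmem
    have hv : v ∈ e₁ ∩ e₂ := h ▸ Set.mem_insert v _
    exact ⟨e₁, (hS _).2 ⟨h₁, hv.1⟩, e₂, (hS _).2 ⟨h₂, hv.2⟩, hne, h⟩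
  obtain ⟨a, ha, b, hb, hab, h1⟩ := key u huv
  obtain ⟨c, hc, d, hd, hcd, h2⟩ := key w hvw
  by_contra! hlt
  -- With at most two hyperedges through `v`, both edges at `v` would equal the single intersection
  -- `a ∩ b`.
  have hSab : ({a, b} : Finset (Set α)) = S := Finset.eq_of_subset_of_card_le
    (by simp [Finset.insert_subset_iff, ha, hb]) (by rw [Finset.card_pair hab]; omega)
  have heq : ({v, u} : Set α) = {v, w} := by
    rw [← hSab, Finset.mem_insert, Finset.mem_singleton] at hc hd
    rcases hc with rfl | rfl <;> rcases hd with rfl | rfl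
    · exact absurd rfl hcd
    · rw [h1, h2]
    · rw [h1, h2, Set.inter_comm]
    · exact absurd rfl hcd
  have hu : u ∈ ({v, w} : Set α) := heq ▸ (by simp)
  rcases hu with h | h
  exacts [huv.ne h.symm, huw h]

/-- If every vertex of `G = EI(H)` has two distinct neighbours and `H` is `k`-uniform, then `H` has
at least `3 |V| / k` hyperedges. -/
theorem three_mul_card_le_of_edgeIntersection_eq [Fintype α] {k : ℕ} {G : SimpleGraph α}
    {H : Hypergraph α} (hk : H.IsUniform k) (hH : H.edgeIntersection = ofSimpleGraph G)
    (hG : ∀ v, ∃ u w, G.Adj v u ∧ G.Adj v w ∧ u ≠ w) :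
    3 * Fintype.card α ≤ k * H.edgeSet.ncard := by
  classical
  have hcount := Finset.sum_card_bipartiteAbove_eq_sum_card_bipartiteBelow
    (s := (Finset.univ : Finset α)) (t := H.edgeSet.toFinset) (fun v e => v ∈ e)
  have hl : Fintype.card α * 3 ≤
      ∑ v, (H.edgeSet.toFinset.bipartiteAbove (fun (v : α) (e : Set α) => v ∈ e) v).card := by
    rw [← Finset.card_univ, ← smul_eq_mul]
    refine Finset.card_nsmul_le_sum _ _ _ fun v _ => ?_
    obtain ⟨u, w, hu, hw, huw⟩ := hG v
    exact three_le_card_of_edgeIntersection_eq hH hu hw huw _ fun e => by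
      simp [Finset.bipartiteAbove]
  have hr : ∑ e ∈ H.edgeSet.toFinset, ((Finset.univ : Finset α).bipartiteBelow
      (fun (v : α) (e : Set α) => v ∈ e) e).card = H.edgeSet.ncard * k := by
    rw [Set.ncard_eq_toFinset_card']
    refine Finset.sum_const_nat fun e he => ?_
    have h := hk e (Set.mem_toFinset.1 he)
    rw [← Set.coe_toFinset e, Set.encard_coe_eq_coe_finsetCard] at h
    have h' : e.toFinset.card = k := by exact_mod_cast h
    rw [← h']
    congr 1
    ext v
    simp [Finset.bipartiteBelow]
  rw [hr] at hcount
  rw [mul_comm 3, mul_comm k]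
  omega

/-! ### Reduction from `Fin n` to sets of naturals -/

theorem cycleGraph_adj_iff {n : ℕ} (hn : 3 ≤ n) (u v : Fin n) :
    (SimpleGraph.cycleGraph n).Adj u v ↔ u.val + 1 = v.val ∨ v.val + 1 = u.val ∨
      (u.val = 0 ∧ v.val + 1 = n) ∨ (v.val = 0 ∧ u.val + 1 = n) := by
  have key : ∀ a b : Fin n, (a - b).val = 1 ↔ b.val + 1 = a.val ∨ (a.val = 0 ∧ b.val + 1 = n) := by
    intro a b
    have ha := a.isLt
    have hb := b.isLt
    rw [Fin.val_sub]
    rcases lt_or_ge (n - b.val + a.val) n with h | h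
    · rw [Nat.mod_eq_of_lt h]
      omega
    · rw [Nat.mod_eq_sub_mod h, Nat.mod_eq_of_lt (by omega)]
      omega
  rw [SimpleGraph.cycleGraph_adj', key, key]
  tauto

/-- A family of `k`-sets of naturals below `n` in which two members share two given points only if
these are adjacent in `C_n`, and which covers each edge of `C_n` twice, is the hyperedge set of a
hypergraph with edge intersection hypergraph `C_n`. -/
theorem exists_edgeIntersection_eq_cycle {n m k : ℕ} (hn : 4 ≤ n) (hk : 3 ≤ k) (E : ℕ → Finset ℕ)
    (hlt : ∀ j < m, ∀ x ∈ E j, x < n) (hcard : ∀ j < m, (E j).card = k)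
    (hpair : ∀ i j, i < j → j < m → ∀ x y, x < y → x ∈ E i → x ∈ E j → y ∈ E i → y ∈ E j →
      x + 1 = y ∨ (x = 0 ∧ y + 1 = n))
    (hcov : ∀ x < n, ∃ i < m, ∃ j < m, i ≠ j ∧ x ∈ E i ∧ x ∈ E j ∧
      (if x + 1 = n then 0 else x + 1) ∈ E i ∧ (if x + 1 = n then 0 else x + 1) ∈ E j) :
    ∃ H : Hypergraph (Fin n), H.IsUniform k ∧ H.edgeIntersection = cycle n ∧
      H.edgeSet.ncard = m := by
  have hadj := cycleGraph_adj_iff (show 3 ≤ n by omega)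
  have hcov' : ∀ x y : Fin n, x.val + 1 = y.val ∨ (y.val = 0 ∧ x.val + 1 = n) →
      ∃ i < m, ∃ j < m, i ≠ j ∧ x.val ∈ E i ∧ x.val ∈ E j ∧ y.val ∈ E i ∧ y.val ∈ E j := by
    intro x y h
    have hy : (if x.val + 1 = n then 0 else x.val + 1) = y.val := by
      have := y.isLt
      split_ifs <;> omega
    have := hcov x x.isLt
    rwa [hy] at this
  refine exists_edgeIntersection_eq_ofSimpleGraph (m := m) _ hk ?_
    (fun j => (E j).attachFin (hlt j j.isLt)) (fun j => ?_) ?_ ?_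
  -- Triangle-freeness of the cycle; this is where `4 ≤ n` is needed.
  · intro x y z
    simp only [hadj]
    omega
  · rw [Finset.card_attachFin, hcard j j.isLt]
  · intro i j hij x y hxy
    simp only [Finset.mem_attachFin, hadj]
    intro h1 h2 h3 h4
    have hij' : i.val ≠ j.val := fun h => hij (Fin.ext h)
    have hxy' : x.val ≠ y.val := fun h => hxy (Fin.ext h)
    rcases lt_or_gt_of_ne hij' with hij | hij <;> rcases lt_or_gt_of_ne hxy' with hxy | hxy
    · have := hpair i j hij j.isLt x y hxy h1 h2 h3 h4
      omega
    · have := hpair i j hij j.isLt y x hxy h3 h4 h1 h2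
      omega
    · have := hpair j i hij i.isLt x y hxy h2 h1 h4 h3
      omega
    · have := hpair j i hij i.isLt y x hxy h4 h3 h2 h1
      omega
  · intro x y
    simp only [hadj, Finset.mem_attachFin]
    intro h
    have h' : (x.val + 1 = y.val ∨ (y.val = 0 ∧ x.val + 1 = n)) ∨
        (y.val + 1 = x.val ∨ (x.val = 0 ∧ y.val + 1 = n)) := by omega
    rcases h' with h | h
    · obtain ⟨i, hi, j, hj, hij, h1, h2, h3, h4⟩ := hcov' x y h
      exact ⟨⟨i, hi⟩, ⟨j, hj⟩, fun h => hij (Fin.mk.inj h), h1, h2, h3, h4⟩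
    · obtain ⟨i, hi, j, hj, hij, h1, h2, h3, h4⟩ := hcov' y x h
      exact ⟨⟨i, hi⟩, ⟨j, hj⟩, fun h => hij (Fin.mk.inj h), h3, h4, h1, h2⟩

/-! ### The explicit 6-uniform families -/

theorem card_six {a b c d e f : ℕ} (h : [a, b, c, d, e, f].Nodup) :
    ({a, b, c, d, e, f} : Finset ℕ).card = 6 := by
  simpa using List.toFinset_card_of_nodup h

/-- The translates by even numbers of `{0, 1, 2, 3, 9, 10}` modulo `2 * q + 24`; the five translates
that meet both ends of the interval `[0, 2 * q + 24)` come first. -/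
def evenFamily (q : ℕ) : ℕ → Finset ℕ
  | 0 => {2 * q + 14, 2 * q + 15, 2 * q + 16, 2 * q + 17, 2 * q + 23, 0}
  | 1 => {2 * q + 16, 2 * q + 17, 2 * q + 18, 2 * q + 19, 1, 2}
  | 2 => {2 * q + 18, 2 * q + 19, 2 * q + 20, 2 * q + 21, 3, 4}
  | 3 => {2 * q + 20, 2 * q + 21, 2 * q + 22, 2 * q + 23, 5, 6}
  | 4 => {2 * q + 22, 2 * q + 23, 0, 1, 7, 8}
  | j + 5 => {2 * j, 2 * j + 1, 2 * j + 2, 2 * j + 3, 2 * j + 9, 2 * j + 10}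

/-- The translates by even numbers of `{0, 1, 2, 3, 9, 10}` modulo `2 * q + 26` with the vertex
`2 * q + 25` deleted and the three hyperedges that contained it repaired. -/
def oddFamily (q : ℕ) : ℕ → Finset ℕ
  | 0 => {2 * q + 16, 2 * q + 17, 2 * q + 18, 2 * q + 19, 0, 4}
  | 1 => {2 * q + 18, 2 * q + 19, 2 * q + 20, 2 * q + 21, 1, 2}
  | 2 => {2 * q + 20, 2 * q + 21, 2 * q + 22, 2 * q + 23, 3, 4}
  | 3 => {2 * q + 22, 2 * q + 23, 2 * q + 24, 0, 5, 6}
  | 4 => {2 * q + 24, 0, 1, 7, 8, 12}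
  | j + 5 => {2 * j, 2 * j + 1, 2 * j + 2, 2 * j + 3, 2 * j + 9, 2 * j + 10}

/-- Two distinct even translates of `{0, 1, 2, 3, 9, 10}` share at most two points, and these are
consecutive. -/
theorem consecutive_of_mem_translates {i j x y : ℕ} (hij : i < j) (hxy : x < y)
    (h1 : x = 2 * i ∨ x = 2 * i + 1 ∨ x = 2 * i + 2 ∨ x = 2 * i + 3 ∨ x = 2 * i + 9 ∨
      x = 2 * i + 10)
    (h2 : x = 2 * j ∨ x = 2 * j + 1 ∨ x = 2 * j + 2 ∨ x = 2 * j + 3 ∨ x = 2 * j + 9 ∨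
      x = 2 * j + 10)
    (h3 : y = 2 * i ∨ y = 2 * i + 1 ∨ y = 2 * i + 2 ∨ y = 2 * i + 3 ∨ y = 2 * i + 9 ∨
      y = 2 * i + 10)
    (h4 : y = 2 * j ∨ y = 2 * j + 1 ∨ y = 2 * j + 2 ∨ y = 2 * j + 3 ∨ y = 2 * j + 9 ∨
      y = 2 * j + 10) : x + 1 = y := by
  -- Fixing the positions of `x` and `y` in the lower translate suffices; `omega` then decides the
  -- disjunctions `h2` and `h4`.
  rcases h1 with rfl | rfl | rfl | rfl | rfl | rfl <;>
  rcases h3 with rfl | rfl | rfl | rfl | rfl | rfl <;>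
  omega

theorem lt_of_mem_evenFamily {q j x : ℕ} (hj : j < q + 12) (hx : x ∈ evenFamily q j) :
    x < 2 * q + 24 := by
  rcases j with _ | _ | _ | _ | _ | j <;>
    simp only [evenFamily, Finset.mem_insert, Finset.mem_singleton] at hx <;> omega

theorem card_evenFamily (q j : ℕ) : (evenFamily q j).card = 6 := by
  rcases j with _ | _ | _ | _ | _ | j <;> apply card_six <;> simp

theorem adj_of_mem_evenFamily {q i j x y : ℕ} (hij : i < j) (hj : j < q + 12) (hxy : x < y)
    (h1 : x ∈ evenFamily q i) (h2 : x ∈ evenFamily q j) (h3 : y ∈ evenFamily q i)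
    (h4 : y ∈ evenFamily q j) : x + 1 = y ∨ (x = 0 ∧ y + 1 = 2 * q + 24) := by
  rcases j with _ | _ | _ | _ | _ | j <;> rcases i with _ | _ | _ | _ | _ | i <;>
    -- The first `omega` discards the index patterns contradicting `i < j`. Two unwrapped translates
    -- fall under the lemma; otherwise `i` is one of the five special indices, and the 36 positions
    -- of `x` and `y` in its member are checked.
    first
      | omega
      | (simp only [evenFamily, Finset.mem_insert, Finset.mem_singleton] at h1 h2 h3 h4
         first
          | exact Or.inl (consecutive_of_mem_translates (by omega) hxy h1 h2 h3 h4)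
          | (rcases h1 with rfl | rfl | rfl | rfl | rfl | rfl <;>
             rcases h3 with rfl | rfl | rfl | rfl | rfl | rfl <;>
             omega))

theorem evenFamily_cover {q x y : ℕ}
    (hxy : (x + 1 = y ∧ y < 2 * q + 24) ∨ (x + 1 = 2 * q + 24 ∧ y = 0)) :
    ∃ i < q + 12, ∃ j < q + 12, i ≠ j ∧ x ∈ evenFamily q i ∧ x ∈ evenFamily q j ∧
      y ∈ evenFamily q i ∧ y ∈ evenFamily q j := by
  -- The listed values are the edges whose covering pair involves a wrapped translate. The generic
  -- edges come from unwrapped translates `i`, `i + 1` (shift 2) or `i`, `i + 4` (shift 8), with `q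
  -- + 7` unwrapped translates in all.
  have hx : x = 0 ∨ x = 1 ∨ x = 3 ∨ x = 5 ∨
      x = 7 ∨ x = 2 * q + 14 ∨ x = 2 * q + 15 ∨ x = 2 * q + 16 ∨
      x = 2 * q + 17 ∨ x = 2 * q + 18 ∨ x = 2 * q + 19 ∨ x = 2 * q + 20 ∨
      x = 2 * q + 21 ∨ x = 2 * q + 22 ∨ x = 2 * q + 23 ∨
      (∃ i, i + 1 < q + 7 ∧ x = 2 * (i + 1)) ∨ (∃ i, i + 4 < q + 7 ∧ x = 2 * (i + 4) + 1) := by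
    by_contra! hne
    obtain ⟨i, hi⟩ := Nat.even_or_odd' x
    -- Truncated subtraction is harmless: 0 and the odd values below 9 are already excluded.
    have he := fun h => (hne.2.2.2.2.2.2.2.2.2.2.2.2.2.2.2).1 (i - 1) h
    have ho := fun h => (hne.2.2.2.2.2.2.2.2.2.2.2.2.2.2.2).2 (i - 4) h
    omega
  rcases hx with h | h | h | h | h | h | h | h | h | h | h | h | h | h | h | ⟨i, hi, h⟩ | ⟨i, hi, h⟩
  · refine ⟨4, by omega, 0 + 5, by omega, by omega, ?_⟩
    simp only [evenFamily, Finset.mem_insert, Finset.mem_singleton]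
    omega
  · refine ⟨1, by omega, 0 + 5, by omega, by omega, ?_⟩
    simp only [evenFamily, Finset.mem_insert, Finset.mem_singleton]
    omega
  · refine ⟨2, by omega, 1 + 5, by omega, by omega, ?_⟩
    simp only [evenFamily, Finset.mem_insert, Finset.mem_singleton]
    omega
  · refine ⟨3, by omega, 2 + 5, by omega, by omega, ?_⟩
    simp only [evenFamily, Finset.mem_insert, Finset.mem_singleton]
    omega
  · refine ⟨4, by omega, 3 + 5, by omega, by omega, ?_⟩
    simp only [evenFamily, Finset.mem_insert, Finset.mem_singleton]
    omega
  · refine ⟨q + 6 + 5, by omega, 0, by omega, by omega, ?_⟩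
    simp only [evenFamily, Finset.mem_insert, Finset.mem_singleton]
    omega
  · refine ⟨0, by omega, q + 3 + 5, by omega, by omega, ?_⟩
    simp only [evenFamily, Finset.mem_insert, Finset.mem_singleton]
    omega
  · refine ⟨0, by omega, 1, by omega, by omega, ?_⟩
    simp only [evenFamily, Finset.mem_insert, Finset.mem_singleton]
    omega
  · refine ⟨1, by omega, q + 4 + 5, by omega, by omega, ?_⟩
    simp only [evenFamily, Finset.mem_insert, Finset.mem_singleton]
    omega
  · refine ⟨1, by omega, 2, by omega, by omega, ?_⟩
    simp only [evenFamily, Finset.mem_insert, Finset.mem_singleton]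
    omega
  · refine ⟨2, by omega, q + 5 + 5, by omega, by omega, ?_⟩
    simp only [evenFamily, Finset.mem_insert, Finset.mem_singleton]
    omega
  · refine ⟨2, by omega, 3, by omega, by omega, ?_⟩
    simp only [evenFamily, Finset.mem_insert, Finset.mem_singleton]
    omega
  · refine ⟨3, by omega, q + 6 + 5, by omega, by omega, ?_⟩
    simp only [evenFamily, Finset.mem_insert, Finset.mem_singleton]
    omega
  · refine ⟨3, by omega, 4, by omega, by omega, ?_⟩
    simp only [evenFamily, Finset.mem_insert, Finset.mem_singleton]
    omega
  · refine ⟨0, by omega, 4, by omega, by omega, ?_⟩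
    simp only [evenFamily, Finset.mem_insert, Finset.mem_singleton]
    omega
  · refine ⟨i + 5, by omega, i + 1 + 5, by omega, by omega, ?_⟩
    simp only [evenFamily, Finset.mem_insert, Finset.mem_singleton]
    omega
  · refine ⟨i + 5, by omega, i + 4 + 5, by omega, by omega, ?_⟩
    simp only [evenFamily, Finset.mem_insert, Finset.mem_singleton]
    omega

theorem lt_of_mem_oddFamily {q j x : ℕ} (hj : j < q + 13) (hx : x ∈ oddFamily q j) :
    x < 2 * q + 25 := by
  rcases j with _ | _ | _ | _ | _ | j <;>
    simp only [oddFamily, Finset.mem_insert, Finset.mem_singleton] at hx <;> omega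

theorem card_oddFamily (q j : ℕ) : (oddFamily q j).card = 6 := by
  rcases j with _ | _ | _ | _ | _ | j <;> apply card_six <;> simp

/-- The deleted vertex is replaced by 4, 0 and 12 in members 0, 3 and 4. The new 0 makes members 3
and 4 meet in the new cycle edge `{2 * q + 24, 0}`. The points 4 and 12 only restore the size six:
any other member containing one of them shares nothing else with the repaired member. -/
theorem adj_of_mem_oddFamily {q i j x y : ℕ} (hij : i < j) (hj : j < q + 13) (hxy : x < y)
    (h1 : x ∈ oddFamily q i) (h2 : x ∈ oddFamily q j) (h3 : y ∈ oddFamily q i)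
    (h4 : y ∈ oddFamily q j) : x + 1 = y ∨ (x = 0 ∧ y + 1 = 2 * q + 25) := by
  rcases j with _ | _ | _ | _ | _ | j <;> rcases i with _ | _ | _ | _ | _ | i <;>
    first
      | omega
      | (simp only [oddFamily, Finset.mem_insert, Finset.mem_singleton] at h1 h2 h3 h4
         first
          | exact Or.inl (consecutive_of_mem_translates (by omega) hxy h1 h2 h3 h4)
          | (rcases h1 with rfl | rfl | rfl | rfl | rfl | rfl <;>
             rcases h3 with rfl | rfl | rfl | rfl | rfl | rfl <;>
             omega))

theorem oddFamily_cover {q x y : ℕ}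
    (hxy : (x + 1 = y ∧ y < 2 * q + 25) ∨ (x + 1 = 2 * q + 25 ∧ y = 0)) :
    ∃ i < q + 13, ∃ j < q + 13, i ≠ j ∧ x ∈ oddFamily q i ∧ x ∈ oddFamily q j ∧
      y ∈ oddFamily q i ∧ y ∈ oddFamily q j := by
  have hx : x = 0 ∨ x = 1 ∨ x = 3 ∨ x = 5 ∨
      x = 7 ∨ x = 2 * q + 16 ∨ x = 2 * q + 17 ∨ x = 2 * q + 18 ∨
      x = 2 * q + 19 ∨ x = 2 * q + 20 ∨ x = 2 * q + 21 ∨ x = 2 * q + 22 ∨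
      x = 2 * q + 23 ∨ x = 2 * q + 24 ∨
      -- Here `q + 8` translates are unwrapped.
      (∃ i, i + 1 < q + 8 ∧ x = 2 * (i + 1)) ∨ (∃ i, i + 4 < q + 8 ∧ x = 2 * (i + 4) + 1) := by
    by_contra! hne
    obtain ⟨i, hi⟩ := Nat.even_or_odd' x
    have he := fun h => (hne.2.2.2.2.2.2.2.2.2.2.2.2.2.2).1 (i - 1) h
    have ho := fun h => (hne.2.2.2.2.2.2.2.2.2.2.2.2.2.2).2 (i - 4) h
    omega
  rcases hx with h | h | h | h | h | h | h | h | h | h | h | h | h | h | ⟨i, hi, h⟩ | ⟨i, hi, h⟩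
  · refine ⟨4, by omega, 0 + 5, by omega, by omega, ?_⟩
    simp only [oddFamily, Finset.mem_insert, Finset.mem_singleton]
    omega
  · refine ⟨1, by omega, 0 + 5, by omega, by omega, ?_⟩
    simp only [oddFamily, Finset.mem_insert, Finset.mem_singleton]
    omega
  · refine ⟨2, by omega, 1 + 5, by omega, by omega, ?_⟩
    simp only [oddFamily, Finset.mem_insert, Finset.mem_singleton]
    omega
  · refine ⟨3, by omega, 2 + 5, by omega, by omega, ?_⟩
    simp only [oddFamily, Finset.mem_insert, Finset.mem_singleton]
    omega
  · refine ⟨4, by omega, 3 + 5, by omega, by omega, ?_⟩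
    simp only [oddFamily, Finset.mem_insert, Finset.mem_singleton]
    omega
  · refine ⟨q + 7 + 5, by omega, 0, by omega, by omega, ?_⟩
    simp only [oddFamily, Finset.mem_insert, Finset.mem_singleton]
    omega
  · refine ⟨0, by omega, q + 4 + 5, by omega, by omega, ?_⟩
    simp only [oddFamily, Finset.mem_insert, Finset.mem_singleton]
    omega
  · refine ⟨0, by omega, 1, by omega, by omega, ?_⟩
    simp only [oddFamily, Finset.mem_insert, Finset.mem_singleton]
    omega
  · refine ⟨1, by omega, q + 5 + 5, by omega, by omega, ?_⟩
    simp only [oddFamily, Finset.mem_insert, Finset.mem_singleton]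
    omega
  · refine ⟨1, by omega, 2, by omega, by omega, ?_⟩
    simp only [oddFamily, Finset.mem_insert, Finset.mem_singleton]
    omega
  · refine ⟨2, by omega, q + 6 + 5, by omega, by omega, ?_⟩
    simp only [oddFamily, Finset.mem_insert, Finset.mem_singleton]
    omega
  · refine ⟨2, by omega, 3, by omega, by omega, ?_⟩
    simp only [oddFamily, Finset.mem_insert, Finset.mem_singleton]
    omega
  · refine ⟨3, by omega, q + 7 + 5, by omega, by omega, ?_⟩
    simp only [oddFamily, Finset.mem_insert, Finset.mem_singleton]
    omega
  · refine ⟨3, by omega, 4, by omega, by omega, ?_⟩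
    simp only [oddFamily, Finset.mem_insert, Finset.mem_singleton]
    omega
  · refine ⟨i + 5, by omega, i + 1 + 5, by omega, by omega, ?_⟩
    simp only [oddFamily, Finset.mem_insert, Finset.mem_singleton]
    omega
  · refine ⟨i + 5, by omega, i + 4 + 5, by omega, by omega, ?_⟩
    simp only [oddFamily, Finset.mem_insert, Finset.mem_singleton]
    omega

/-! ### Existence for both parities, and the value of `mu` -/

theorem exists_isUniform_six_edgeIntersection_eq_cycle {n : ℕ} (hn : 24 ≤ n) :
    ∃ H : Hypergraph (Fin n), H.IsUniform 6 ∧ H.edgeIntersection = cycle n ∧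
      H.edgeSet.ncard = (n + 1) / 2 := by
  obtain ⟨q, rfl | rfl⟩ : ∃ q, n = 2 * q + 24 ∨ n = 2 * q + 25 := ⟨(n - 24) / 2, by omega⟩
  · rw [show (2 * q + 24 + 1) / 2 = q + 12 by omega]
    exact exists_edgeIntersection_eq_cycle (by omega) (by omega) (evenFamily q)
      (fun j hj x => lt_of_mem_evenFamily hj) (fun j _ => card_evenFamily q j)
      (fun i j hij hj x y hxy => adj_of_mem_evenFamily hij hj hxy)
      (fun x hx => evenFamily_cover (by split_ifs <;> omega))
  · rw [show (2 * q + 25 + 1) / 2 = q + 13 by omega]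
    exact exists_edgeIntersection_eq_cycle (by omega) (by omega) (oddFamily q)
      (fun j hj x => lt_of_mem_oddFamily hj) (fun j _ => card_oddFamily q j)
      (fun i j hij hj x y hxy => adj_of_mem_oddFamily hij hj hxy)
      (fun x hx => oddFamily_cover (by split_ifs <;> omega))

theorem exists_two_adj_cycleGraph {n : ℕ} (hn : 3 ≤ n) (v : Fin n) :
    ∃ u w, (SimpleGraph.cycleGraph n).Adj v u ∧ (SimpleGraph.cycleGraph n).Adj v w ∧ u ≠ w := by
  have hv := v.isLt
  have hs : ∃ a < n, v.val + 1 = a ∨ (a = 0 ∧ v.val + 1 = n) := by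
    rcases Nat.lt_or_ge (v.val + 1) n with h | h
    exacts [⟨v.val + 1, h, Or.inl rfl⟩, ⟨0, by omega, by omega⟩]
  have hp : ∃ b < n, b + 1 = v.val ∨ (v.val = 0 ∧ b + 1 = n) := by
    rcases Nat.eq_zero_or_pos v.val with h | h
    exacts [⟨n - 1, by omega, by omega⟩, ⟨v.val - 1, by omega, by omega⟩]
  obtain ⟨a, ha, hva⟩ := hs
  obtain ⟨b, hb, hvb⟩ := hp
  refine ⟨⟨a, ha⟩, ⟨b, hb⟩, (cycleGraph_adj_iff hn _ _).2 ?_, (cycleGraph_adj_iff hn _ _).2 ?_,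
    fun h => ?_⟩
  · dsimp only
    omega
  · dsimp only
    omega
  · have := Fin.mk.inj h
    omega

end Hypergraph

theorem corollary2p5 (n : ℕ) (hn : 24 ≤ n) :
    (∃ H : Hypergraph (Fin n), H.IsUniform 6 ∧
      H.edgeIntersection = Hypergraph.cycle n ∧
      H.edgeSet.ncard = ⌈(n : ℚ) / 2⌉₊) ∧
    Hypergraph.mu 6 n = ⌈(n : ℚ) / 2⌉₊ := by
  have hceil : ⌈(n : ℚ) / 2⌉₊ = (n + 1) / 2 := by
    refine (Nat.ceil_eq_iff (by omega)).2 ⟨?_, ?_⟩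
    · rw [lt_div_iff₀ two_pos]
      exact_mod_cast (by omega : ((n + 1) / 2 - 1) * 2 < n)
    · rw [div_le_iff₀ two_pos]
      exact_mod_cast (by omega : n ≤ (n + 1) / 2 * 2)
  rw [hceil]
  have hex := Hypergraph.exists_isUniform_six_edgeIntersection_eq_cycle hn
  -- The witness `hex` makes the set nonempty, so the default value 0 of `sInf` plays no role.
  refine ⟨hex, le_antisymm (Nat.sInf_le hex) (le_csInf ⟨_, hex⟩ ?_)⟩
  rintro m ⟨H, hu, hH, rfl⟩
  have := Hypergraph.three_mul_card_le_of_edgeIntersection_eq hu hH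
    (Hypergraph.exists_two_adj_cycleGraph (by omega))
  rw [Fintype.card_fin] at this
  omega
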